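/- Let $0<\alpha<1$, $L_0>0$, $T>0$, and for $t\ge 0$ put \[ I_0=\frac{1}{\Gamma(1-\alpha)}\int_0^{L_0}x^{-\alpha}e^{-tx}\,dx,\qquad f_0(x)=\frac{1}{\Gamma(1-\alpha)}\Big(\frac{L_0}{2}\Big)^{1-\alpha}e^{-t(x+1)L_0/2},\qquad w(x)=(1+x)^{-\alpha}. \] For an integer $Q\ge 1$ let $x_1,\dots,x_Q$ and $w_1,\dots,w_Q$ be the nodes and weights of the $Q$-point Gauss quadrature formula on $[-1,1]$ with weight function $w$ (Gauss–Jacobi quadrature): the $x_j$ are the zeros of the degree-$Q$ orthogonal polynomial for $w$ on $[-1,1]$, and $w_j=\int_{-1}^1 w(x)\ell_j(x)\,dx$ with $\ell_j$ the Lagrange basis polynomials of the nodes. Let \[ \tau_{\mathrm{GJ}}(Q)=\int_{-1}^1 f_0(x)w(x)\,dx-\sum_{j=1}^{Q}w_jf_0(x_j). \] Then, for every $t\in[0,T]$ and every integer $Q\ge 1$, $I_0=\int_{-1}^1 f_0(x)w(x)\,dx$ (so that $\tau_{\mathrm{GJ}}(Q)$ is the Gauss–Jacobi quadrature error for $I_0$),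 and \[ |\tau_{\mathrm{GJ}}(Q)|\le\frac{4L_0^{1-\alpha}}{\Gamma(2-\alpha)}\Big(1+\frac{TL_0}{4Q}\Big)\Big(\frac{eTL_0}{8Q}\Big)^{2Q}. \] -/

import Mathlib

open Polynomial

noncomputable section

namespace GaussJacobi

/-- The weighted inner product `∫_{-1}^1 w(x) p(x) q(x) dx` of two real polynomials. -/
def weightedInner (w : ℝ → ℝ) (p q : ℝ[X]) : ℝ :=
  ∫ x in (-1 : ℝ)..1, w x * (p.eval x * q.eval x)

/-- The monic orthogonal polynomial of degree `n` on `[-1,1]` with respect to the weight `w`,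
obtained from `1, X, X², …` by Gram–Schmidt orthogonalization. -/
def orthoPoly (w : ℝ → ℝ) (n : ℕ) : ℝ[X] :=
  X ^ n - ∑ k : Fin n,
    C (weightedInner w (X ^ n) (orthoPoly w k) /
        weightedInner w (orthoPoly w k) (orthoPoly w k)) * orthoPoly w k
termination_by n
decreasing_by all_goals exact k.isLt

/-- The nodes of the `Q`-point Gauss formula for the weight `w` on `[-1,1]`: the zeros of the
orthogonal polynomial of degree `Q`. -/
def gaussNodes (w : ℝ → ℝ) (Q : ℕ) : Finset ℝ :=
  (orthoPoly w Q).roots.toFinset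

/-- The weight of the `Q`-point Gauss formula at the node `ξ`: the integral against `w` of the
Lagrange basis polynomial of the node `ξ`. -/
def gaussWeight (w : ℝ → ℝ) (Q : ℕ) (ξ : ℝ) : ℝ :=
  ∫ x in (-1 : ℝ)..1, w x * (Lagrange.basis (gaussNodes w Q) id ξ).eval x

/-- The `Q`-point Gauss formula `I_Q f = ∑ⱼ wⱼ f(xⱼ)` for the weight `w` on `[-1,1]`. -/
def gaussQuadrature (w : ℝ → ℝ) (Q : ℕ) (f : ℝ → ℝ) : ℝ :=
  ∑ ξ ∈ gaussNodes w Q, gaussWeight w Q ξ * f ξ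

/-- The Jacobi weight `(1 + x)^{-α}`. -/
def jacobiWeight (α : ℝ) (x : ℝ) : ℝ := (1 + x) ^ (-α)

/-- The transformed integrand
`f₀(x) = (1/Γ(1-α)) (L₀/2)^{1-α} e^{-t(x+1)L₀/2}` on the reference interval `[-1,1]`. -/
def f₀ (α L₀ t : ℝ) (x : ℝ) : ℝ :=
  1 / Real.Gamma (1 - α) * (L₀ / 2) ^ (1 - α) * Real.exp (-t * (x + 1) * L₀ / 2)

/-- The initial integral `I₀ = (1/Γ(1-α)) ∫₀^{L₀} x^{-α} e^{-tx} dx`. -/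
def I₀ (α L₀ t : ℝ) : ℝ :=
  1 / Real.Gamma (1 - α) * ∫ x in (0 : ℝ)..L₀, x ^ (-α) * Real.exp (-t * x)

/-- The Gauss–Jacobi error `τ_GJ(Q) = ∫_{-1}^1 f₀(x) w(x) dx - ∑ⱼ wⱼ f₀(xⱼ)`. -/
def tauGJ (α L₀ t : ℝ) (Q : ℕ) : ℝ :=
  (∫ x in (-1 : ℝ)..1, f₀ α L₀ t x * jacobiWeight α x) -
    gaussQuadrature (jacobiWeight α) Q (f₀ α L₀ t)

end GaussJacobi

end

namespace GaussJacobi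

open scoped ContDiff

/-! ### Lagrange interpolation error -/

/-! The Gauss formula is exact in degree below `2Q` and has nonnegative weights of total mass `∫ w`,
so its error is at most `2 ∫ w` times the uniform distance from `f₀` to polynomials of degree below
`2Q` (`abs_integral_sub_gaussQuadrature_le`). Interpolation at the `2Q` Chebyshev zeros bounds that
distance by `max |f₀^(2Q)| / ((2Q)! 2^(2Q-1))` (`exists_polynomial_approx`). Since `f₀` is an
exponential of rate `tL₀/2` and `∫ w = 2^(1-α)/(1-α)`, the error is at most `4 L₀^(1-α)/Γ(2-α) ·
(tL₀/4)^(2Q)/(2Q)!` (`abs_tauGJ_le`). Finally `n! ≥ (n/e)^n` with `n = 2Q` gives the stated power;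
the factor `1 + TL₀/(4Q)` is slack. -/

theorem contDiff_eval (p : ℝ[X]) (n : WithTop ℕ∞) : ContDiff ℝ n fun x => p.eval x := by
  simpa only [coe_aeval_eq_eval] using p.contDiff_aeval (𝕜 := ℝ) n

theorem iteratedDeriv_polynomial (p : ℝ[X]) (n : ℕ) :
    iteratedDeriv n (fun x => p.eval x) = fun x => (derivative^[n] p).eval x := by
  induction n generalizing p with
  | zero => simp
  | succ n ih =>
    rw [iteratedDeriv_succ', Function.iterate_succ_apply, ← ih]
    congr 1
    ext x
    simp

theorem iteratedDeriv_polynomial_of_natDegree_le {p : ℝ[X]} {n : ℕ} (hp : p.natDegree ≤ n)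
    (x : ℝ) : iteratedDeriv n (fun x => p.eval x) x = n.factorial * p.coeff n := by
  have hd : (derivative^[n] p).natDegree = 0 := by
    have := natDegree_iterate_derivative p n
    omega
  rw [iteratedDeriv_polynomial]
  beta_reduce
  rw [eq_C_of_natDegree_eq_zero hd, eval_C, coeff_iterate_derivative]
  simp [Nat.descFactorial_self]

/-- Iterated Rolle theorem for an increasing enumeration of zeros. -/
theorem exists_iteratedDeriv_eq_zero_of_strictMono {a b : ℝ} (n : ℕ) {f : ℝ → ℝ}
    (hf : ContDiff ℝ ∞ f) (z : ℕ → ℝ) (hz : ∀ i < n, z i < z (i + 1))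
    (hmem : ∀ i ≤ n, z i ∈ Set.Icc a b) (hzero : ∀ i ≤ n, f (z i) = 0) :
    ∃ c ∈ Set.Icc a b, iteratedDeriv n f c = 0 := by
  induction n generalizing f z with
  | zero => exact ⟨z 0, hmem 0 le_rfl, by simpa using hzero 0 le_rfl⟩
  | succ n ih =>
    -- The bound on `i` sits inside the existential so that `choose` yields a total sequence; `0` is
    -- a junk value.
    have key : ∀ i, ∃ c, i < n + 1 → c ∈ Set.Ioo (z i) (z (i + 1)) ∧ deriv f c = 0 := by
      intro i
      by_cases hi : i < n + 1
      · obtain ⟨c, hc, h⟩ := exists_deriv_eq_zero (hz i hi) hf.continuous.continuousOn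
          ((hzero i hi.le).trans (hzero (i + 1) hi).symm)
        exact ⟨c, fun _ => ⟨hc, h⟩⟩
      · exact ⟨0, fun h => absurd h hi⟩
    choose y hy using key
    rw [iteratedDeriv_succ']
    refine ih (contDiff_infty_iff_deriv.mp hf).2 y (fun i hi => ?_) (fun i hi => ?_)
      fun i hi => (hy i (by omega)).2
    · exact (hy i (by omega)).1.2.trans (hy (i + 1) (by omega)).1.1
    · have h := (hy i (by omega)).1
      exact ⟨(hmem i (by omega)).1.trans h.1.le, h.2.le.trans (hmem (i + 1) (by omega)).2⟩

/-- Iterated Rolle theorem: a smooth function with `n + 1` zeros in `[a, b]` has a zero of its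
`n`-th derivative there. -/
theorem exists_iteratedDeriv_eq_zero {a b : ℝ} {n : ℕ} {f : ℝ → ℝ} (hf : ContDiff ℝ ∞ f)
    (s : Finset ℝ) (hs : s.card = n + 1) (hmem : ∀ x ∈ s, x ∈ Set.Icc a b)
    (hzero : ∀ x ∈ s, f x = 0) : ∃ c ∈ Set.Icc a b, iteratedDeriv n f c = 0 := by
  let e := s.orderEmbOfFin hs
  have he : ∀ i, e i ∈ s := s.orderEmbOfFin_mem hs
  let z : ℕ → ℝ := fun i => if h : i < n + 1 then e ⟨i, h⟩ else 0
  have hz : ∀ i (h : i < n + 1), z i = e ⟨i, h⟩ := fun i h => dif_pos h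
  refine exists_iteratedDeriv_eq_zero_of_strictMono n hf z (fun i hi => ?_) (fun i hi => ?_)
    fun i hi => ?_
  · rw [hz i (by omega), hz (i + 1) (by omega)]
    exact e.strictMono (by simp)
  · rw [hz i (by omega)]
    exact hmem _ (he _)
  · rw [hz i (by omega)]
    exact hzero _ (he _)

/-- The error of Lagrange interpolation. -/
theorem exists_sub_eval_interpolate_eq {a b : ℝ} {n : ℕ} {f : ℝ → ℝ} (hf : ContDiff ℝ ∞ f)
    (s : Finset ℝ) (hs : s.card = n) (hmem : ∀ x ∈ s, x ∈ Set.Icc a b) {x : ℝ}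
    (hx : x ∈ Set.Icc a b) :
    ∃ c ∈ Set.Icc a b, f x - (Lagrange.interpolate s id f).eval x =
      iteratedDeriv n f c / n.factorial * (Lagrange.nodal s id).eval x := by
  have hinj : Set.InjOn (id : ℝ → ℝ) s := Function.injective_id.injOn
  by_cases hxs : x ∈ s
  · refine ⟨x, hx, ?_⟩
    have h1 := Lagrange.eval_interpolate_at_node (r := f) hinj hxs
    have h2 := Lagrange.eval_nodal_at_node (R := ℝ) (v := id) hxs
    simp only [id] at h1 h2
    rw [h1, h2]
    simp
  set p := Lagrange.interpolate s id f
  set N := Lagrange.nodal s (id : ℝ → ℝ)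
  have hN : N.eval x ≠ 0 := Lagrange.eval_nodal_not_at_node fun i hi h => hxs (by simpa [h] using hi)
  -- This `K` makes `f - q` vanish at `x` as well as on `s`, giving `n + 1` zeros; as `N` is monic
  -- of degree `n`, the `n`-th derivative of `q` is the constant `n! K`.
  set K := (f x - p.eval x) / N.eval x with hK
  set q : ℝ[X] := p + C K * N with hq
  have hpdeg : p.degree < n := hs ▸ Lagrange.degree_interpolate_lt f hinj
  have hNdeg : N.natDegree = n := by rw [Lagrange.natDegree_nodal, hs]
  have hNmonic : N.Monic := Lagrange.nodal_monic
  have hqdeg : q.natDegree ≤ n := by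
    refine natDegree_add_le_of_degree_le (natDegree_le_of_degree_le hpdeg.le) ?_
    exact (natDegree_C_mul_le _ _).trans hNdeg.le
  have hqcoeff : q.coeff n = K := by
    rw [hq, coeff_add, coeff_eq_zero_of_degree_lt hpdeg, coeff_C_mul, ← hNdeg,
      hNmonic.coeff_natDegree]
    ring
  have hqs : ContDiff ℝ ∞ fun y => q.eval y := contDiff_eval q _
  obtain ⟨c, hc, h⟩ := exists_iteratedDeriv_eq_zero (n := n) (hf.sub hqs) (insert x s)
    (by rw [Finset.card_insert_of_notMem hxs, hs]) (a := a) (b := b)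
    (by
      intro y hy
      rcases Finset.mem_insert.mp hy with rfl | hy
      exacts [hx, hmem y hy])
    (by
      intro y hy
      rcases Finset.mem_insert.mp hy with rfl | hy
      · simp only [hq, hK, eval_add, eval_mul, eval_C]
        field_simp
        ring
      · have h1 : p.eval y = f y := Lagrange.eval_interpolate_at_node (r := f) hinj hy
        have h2 : N.eval y = 0 := Lagrange.eval_nodal_at_node (R := ℝ) (v := id) hy
        simp [hq, h1, h2])
  refine ⟨c, hc, ?_⟩
  have hfn : ContDiff ℝ n f := hf.of_le (by exact_mod_cast le_top)
  have hqn : ContDiff ℝ n fun y => q.eval y := contDiff_eval q _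
  rw [iteratedDeriv_fun_sub hfn.contDiffAt hqn.contDiffAt,
    iteratedDeriv_polynomial_of_natDegree_le hqdeg, hqcoeff, sub_eq_zero] at h
  rw [h, hK]
  have : (n.factorial : ℝ) ≠ 0 := by positivity
  field_simp

/-! ### Interpolation at the Chebyshev nodes -/

/-- The zeros of the Chebyshev polynomial of degree `n`. -/
noncomputable def chebyshevNodes (n : ℕ) : Finset ℝ := (Chebyshev.T ℝ n).roots.toFinset

theorem card_roots_chebyshev_T (n : ℕ) :
    (Chebyshev.T ℝ n).roots.card = n ∧ (Chebyshev.T ℝ n).roots.Nodup := by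
  rw [Chebyshev.roots_T_real]
  refine ⟨?_, Finset.nodup _⟩
  have h := Chebyshev.roots_T_real_nodup n
  rw [Finset.card_val, Finset.card_image_of_injOn, Finset.card_range]
  exact fun i hi j hj hij => Multiset.inj_on_of_nodup_map h i hi j hj hij

theorem two_pow_mul_nodal_chebyshevNodes (n : ℕ) :
    C (2 ^ (n - 1)) * Lagrange.nodal (chebyshevNodes n) id = Chebyshev.T ℝ n := by
  obtain ⟨h1, h2⟩ := card_roots_chebyshev_T n
  have h := C_leadingCoeff_mul_prod_multiset_X_sub_C (p := Chebyshev.T ℝ n)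
    (by rw [h1, Chebyshev.natDegree_T]; simp)
  rw [Chebyshev.leadingCoeff_T] at h
  conv_rhs => rw [← h]
  congr 1
  rw [Lagrange.nodal, Finset.prod, chebyshevNodes, Multiset.toFinset_val, h2.dedup]
  rfl

theorem chebyshevNodes_mem_Icc {n : ℕ} (hn : n ≠ 0) {x : ℝ} (hx : x ∈ chebyshevNodes n) :
    x ∈ Set.Icc (-1 : ℝ) 1 := by
  rw [chebyshevNodes, Multiset.mem_toFinset] at hx
  have h0 : (Chebyshev.T ℝ n).eval x = 0 := isRoot_of_mem_roots hx
  exact abs_le.mp ((Chebyshev.abs_eval_T_real_le_one_iff (Nat.cast_ne_zero.mpr hn) x).mpr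
    (by rw [h0, abs_zero]; exact zero_le_one))

/-- The monic nodal polynomial of the Chebyshev zeros is `T_n / 2^(n-1)`, hence at most `2^(1-n)` in
absolute value on `[-1,1]`. -/
theorem exists_polynomial_approx {n : ℕ} (hn : n ≠ 0) {f : ℝ → ℝ} (hf : ContDiff ℝ ∞ f) {M : ℝ}
    (hM : ∀ x ∈ Set.Icc (-1 : ℝ) 1, |iteratedDeriv n f x| ≤ M) :
    ∃ p : ℝ[X], p.degree < n ∧ ∀ x ∈ Set.Icc (-1 : ℝ) 1,
      |f x - p.eval x| ≤ M / n.factorial / 2 ^ (n - 1) := by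
  have hcard : (chebyshevNodes n).card = n := by
    obtain ⟨h1, h2⟩ := card_roots_chebyshev_T n
    rw [chebyshevNodes, Multiset.toFinset_card_of_nodup h2, h1]
  refine ⟨Lagrange.interpolate (chebyshevNodes n) id f, ?_, fun x hx => ?_⟩
  · have := Lagrange.degree_interpolate_lt (s := chebyshevNodes n) (v := id) f
      Function.injective_id.injOn
    rwa [hcard] at this
  obtain ⟨c, hc, h⟩ := exists_sub_eval_interpolate_eq hf _ hcard
    (fun _ => chebyshevNodes_mem_Icc hn) hx
  have hT := Chebyshev.abs_eval_T_real_le_one n (abs_le.mpr hx)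
  rw [← two_pow_mul_nodal_chebyshevNodes n, eval_mul, eval_C, abs_mul,
    abs_of_pos (by positivity : (0 : ℝ) < 2 ^ (n - 1))] at hT
  have hM0 : 0 ≤ M := (abs_nonneg _).trans (hM c hc)
  rw [h, abs_mul, abs_div, Nat.abs_cast, div_eq_mul_inv (M / _)]
  refine mul_le_mul (by gcongr; exact hM c hc) ?_ (abs_nonneg _) (by positivity)
  rwa [← one_div, le_div_iff₀' (by positivity)]

/-! ### Orthogonal polynomials for a positive weight -/

theorem intervalIntegrable_weight_mul {w : ℝ → ℝ}
    (hw : IntervalIntegrable w MeasureTheory.volume (-1) 1) {g : ℝ → ℝ} (hg : Continuous g) :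
    IntervalIntegrable (fun x => w x * g x) MeasureTheory.volume (-1) 1 :=
  hw.mul_continuousOn hg.continuousOn

/-- The integrand is positive off the finite set of roots and the endpoint `1`, so a zero integral
would make `(-1,1]` a null set. -/
theorem integral_weight_mul_pos {w : ℝ → ℝ}
    (hw : IntervalIntegrable w MeasureTheory.volume (-1) 1) (hpos : ∀ x ∈ Set.Ioo (-1 : ℝ) 1, 0 < w x)
    {p : ℝ[X]} (hp : p ≠ 0) (hnn : ∀ x ∈ Set.Ioo (-1 : ℝ) 1, 0 ≤ p.eval x) :
    0 < ∫ x in (-1 : ℝ)..1, w x * p.eval x := by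
  have hae : ∀ᵐ x : ℝ, x ≠ 1 ∧ x ∉ p.roots.toFinset := by
    have h1 : ∀ᵐ x : ℝ, x ∉ insert (1 : ℝ) p.roots.toFinset := by
      have := (Finset.finite_toSet (insert (1 : ℝ) p.roots.toFinset)).measure_zero
        MeasureTheory.volume
      simpa using MeasureTheory.measure_eq_zero_iff_ae_notMem.mp this
    filter_upwards [h1] with x hx
    rw [Finset.mem_insert, not_or] at hx
    exact hx
  have hpp : ∀ᵐ x : ℝ, x ∈ Set.Ioc (-1 : ℝ) 1 → 0 < w x * p.eval x := by
    filter_upwards [hae] with x hx hmem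
    have hx' : x ∈ Set.Ioo (-1 : ℝ) 1 := ⟨hmem.1, lt_of_le_of_ne hmem.2 hx.1⟩
    refine mul_pos (hpos x hx') (lt_of_le_of_ne (hnn x hx') fun h => hx.2 ?_)
    rw [Multiset.mem_toFinset, mem_roots hp]
    exact h.symm
  have hi := intervalIntegrable_weight_mul hw p.continuous
  have hnn' : 0 ≤ᵐ[MeasureTheory.volume.restrict (Set.Ioc (-1 : ℝ) 1)]
      fun x => w x * p.eval x := by
    rw [Filter.EventuallyLE, MeasureTheory.ae_restrict_iff' measurableSet_Ioc]
    filter_upwards [hpp] with x hx hm using (hx hm).le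
  rw [intervalIntegral.integral_of_le (by norm_num)]
  refine lt_of_le_of_ne (MeasureTheory.integral_nonneg_of_ae hnn') fun h => ?_
  have h0 := (MeasureTheory.integral_eq_zero_iff_of_nonneg_ae hnn' hi.1).mp h.symm
  rw [Filter.EventuallyEq, MeasureTheory.ae_restrict_iff' measurableSet_Ioc] at h0
  have hfalse : ∀ᵐ x : ℝ, x ∉ Set.Ioc (-1 : ℝ) 1 := by
    filter_upwards [hpp, h0] with x hx hx0 hm
    exact (hx hm).ne' (hx0 hm)
  have := MeasureTheory.measure_eq_zero_iff_ae_notMem.mpr hfalse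
  rw [Real.volume_Ioc] at this
  norm_num at this

/-- The functional `∫ w p`, as a linear map on polynomials. -/
noncomputable def weightedIntegral (w : ℝ → ℝ) (hw : IntervalIntegrable w MeasureTheory.volume (-1) 1) :
    ℝ[X] →ₗ[ℝ] ℝ where
  toFun p := ∫ x in (-1 : ℝ)..1, w x * p.eval x
  map_add' p q := by
    rw [← intervalIntegral.integral_add (intervalIntegrable_weight_mul hw p.continuous)
      (intervalIntegrable_weight_mul hw q.continuous)]
    simp [mul_add]
  map_smul' c p := by
    rw [RingHom.id_apply, smul_eq_mul, ← intervalIntegral.integral_const_mul]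
    refine intervalIntegral.integral_congr fun x _ => ?_
    simp only [eval_smul, smul_eq_mul]
    ring

theorem weightedInner_eq {w : ℝ → ℝ} (hw : IntervalIntegrable w MeasureTheory.volume (-1) 1)
    (p q : ℝ[X]) : weightedInner w p q = weightedIntegral w hw (p * q) := by
  simp [weightedInner, weightedIntegral]

theorem degree_orthoPoly_sum_lt (w : ℝ → ℝ) (n : ℕ)
    (h : ∀ k < n, (orthoPoly w k).degree = k) (c : Fin n → ℝ) :
    (∑ k : Fin n, C (c k) * orthoPoly w k).degree < n := by
  rw [degree_lt_iff_coeff_zero]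
  intro m hm
  rw [finsetSum_coeff]
  refine Finset.sum_eq_zero fun k _ => ?_
  rw [coeff_C_mul, coeff_eq_zero_of_degree_lt, mul_zero]
  rw [h k k.isLt]
  exact_mod_cast k.isLt.trans_le hm

theorem degree_orthoPoly (w : ℝ → ℝ) (n : ℕ) : (orthoPoly w n).degree = n := by
  induction n using Nat.strong_induction_on with
  | _ n ih =>
    rw [orthoPoly, degree_sub_eq_left_of_degree_lt, degree_X_pow]
    rw [degree_X_pow]
    exact degree_orthoPoly_sum_lt w n ih _

theorem orthoPoly_monic (w : ℝ → ℝ) (n : ℕ) : (orthoPoly w n).Monic := by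
  rw [orthoPoly]
  exact monic_X_pow_sub (degree_orthoPoly_sum_lt w n (fun k _ => degree_orthoPoly w k) _)

theorem natDegree_orthoPoly (w : ℝ → ℝ) (n : ℕ) : (orthoPoly w n).natDegree = n :=
  natDegree_eq_of_degree_eq_some (degree_orthoPoly w n)

section Weight

variable {w : ℝ → ℝ} (hw : IntervalIntegrable w MeasureTheory.volume (-1) 1)
  (hpos : ∀ x ∈ Set.Ioo (-1 : ℝ) 1, 0 < w x)
include hpos

theorem weightedIntegral_sq_pos {p : ℝ[X]} (hp : p ≠ 0) : 0 < weightedIntegral w hw (p * p) :=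
  integral_weight_mul_pos hw hpos (mul_ne_zero hp hp) fun x _ => by
    rw [eval_mul]
    exact mul_self_nonneg _

theorem weightedIntegral_orthoPoly_mul_of_lt {m n : ℕ} (h : m < n) :
    weightedIntegral w hw (orthoPoly w n * orthoPoly w m) = 0 := by
  induction n using Nat.strong_induction_on generalizing m with
  | _ n ih =>
    have hne := (weightedIntegral_sq_pos hw hpos (orthoPoly_monic w m).ne_zero).ne'
    rw [orthoPoly, sub_mul, map_sub, Finset.sum_mul, map_sum,
      -- By induction the earlier polynomials are mutually orthogonal, so only the `m`-th
      -- Gram–Schmidt term survives, and its coefficient is chosen to cancel `X ^ n`.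
      Finset.sum_eq_single (⟨m, h⟩ : Fin n)]
    · rw [mul_assoc, ← smul_eq_C_mul, map_smul, weightedInner_eq hw, weightedInner_eq hw,
        smul_eq_mul, div_mul_cancel₀ _ hne, sub_self]
    · intro k _ hk
      rw [mul_assoc, ← smul_eq_C_mul, map_smul]
      have hkm : (k : ℕ) ≠ m := fun h => hk (Fin.ext h)
      rcases hkm.lt_or_gt with hlt | hlt
      · rw [mul_comm (orthoPoly w k), ih m h hlt, smul_zero]
      · rw [ih k k.isLt hlt, smul_zero]
    · simp

theorem weightedIntegral_orthoPoly_mul_eq_zero {n : ℕ} {p : ℝ[X]} (hp : p.degree < n) :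
    weightedIntegral w hw (orthoPoly w n * p) = 0 := by
  suffices H : ∀ m, m ≤ n → ∀ p : ℝ[X], p.degree < m →
      weightedIntegral w hw (orthoPoly w n * p) = 0 from H n le_rfl p hp
  intro m
  induction m with
  | zero =>
    intro _ p hp
    have : p = 0 := by simpa [Nat.WithBot.lt_zero_iff] using hp
    simp [this]
  | succ m ih =>
    intro hm p hp
    have hle : p.degree ≤ m := Order.le_of_lt_succ (by exact_mod_cast hp)
    -- Subtracting this multiple of the monic `orthoPoly w m` removes the coefficient of degree `m`.
    have hdecomp : p = (p - C (p.coeff m) * orthoPoly w m) + C (p.coeff m) * orthoPoly w m := by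
      ring
    have hlt : (p - C (p.coeff m) * orthoPoly w m).degree < m := by
      rw [degree_lt_iff_coeff_zero]
      intro k hk
      rw [coeff_sub, coeff_C_mul]
      rcases hk.eq_or_lt with rfl | hk
      · have := (orthoPoly_monic w m).coeff_natDegree
        rw [natDegree_orthoPoly] at this
        rw [this]
        ring
      · have hk' : (m : WithBot ℕ) < k := by exact_mod_cast hk
        rw [coeff_eq_zero_of_degree_lt (hle.trans_lt hk'),
          coeff_eq_zero_of_degree_lt ((degree_orthoPoly w m).trans_lt hk')]
        ring
    rw [hdecomp, mul_add, map_add, ih (by omega) _ hlt, mul_left_comm, ← smul_eq_C_mul, map_smul,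
      weightedIntegral_orthoPoly_mul_of_lt hw hpos hm]
    simp

end Weight

/-- Every nonzero polynomial can be given a constant sign on an interval through multiplication
by simple factors at some of its roots there. -/
theorem exists_finset_roots_constant_sign (a b : ℝ) (p : ℝ[X]) (hp : p ≠ 0) :
    ∃ R : Finset ℝ, (∀ r ∈ R, r ∈ Set.Ioo a b ∧ p.eval r = 0) ∧
      ((∀ x ∈ Set.Ioo a b, 0 ≤ (p * Lagrange.nodal R id).eval x) ∨
        ∀ x ∈ Set.Ioo a b, (p * Lagrange.nodal R id).eval x ≤ 0) := by
  induction hn : p.natDegree using Nat.strong_induction_on generalizing p with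
  | _ n ih =>
    by_cases hroot : ∃ r ∈ Set.Ioo a b, p.eval r = 0
    · obtain ⟨r, hr, hr0⟩ := hroot
      obtain ⟨q, rfl⟩ := dvd_iff_isRoot.mpr hr0
      have hq : q ≠ 0 := right_ne_zero_of_mul hp
      have hdeg : q.natDegree < n := by
        rw [← hn, natDegree_mul (X_sub_C_ne_zero r) hq, natDegree_X_sub_C]
        omega
      obtain ⟨R, hR, hsign⟩ := ih _ hdeg q hq rfl
      -- If `R` already contains `r`, the factor `X - r` of the polynomial replaces the one in the
      -- nodal polynomial; otherwise adding `r` makes it a square. The sign is kept either way.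
      by_cases hrR : r ∈ R
      · refine ⟨R.erase r, fun s hs => ?_, ?_⟩
        · obtain ⟨h1, h2⟩ := hR s (Finset.mem_of_mem_erase hs)
          exact ⟨h1, by rw [eval_mul, h2, mul_zero]⟩
        · have : (X - C r) * q * Lagrange.nodal (R.erase r) id = q * Lagrange.nodal R id := by
            rw [Lagrange.nodal_eq_mul_nodal_erase hrR, id]
            ring
          rwa [this]
      · refine ⟨insert r R, fun s hs => ?_, ?_⟩
        · rcases Finset.mem_insert.mp hs with rfl | hs
          · exact ⟨hr, hr0⟩
          · obtain ⟨h1, h2⟩ := hR s hs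
            exact ⟨h1, by rw [eval_mul, h2, mul_zero]⟩
        · have : (X - C r) * q * Lagrange.nodal (insert r R) id =
              (X - C r) ^ 2 * (q * Lagrange.nodal R id) := by
            rw [Lagrange.nodal_insert_eq_nodal hrR, id]
            ring
          rw [this]
          refine hsign.imp (fun h x hx => ?_) fun h x hx => ?_
          · rw [eval_mul, eval_pow]
            exact mul_nonneg (sq_nonneg _) (h x hx)
          · rw [eval_mul, eval_pow]
            exact mul_nonpos_of_nonneg_of_nonpos (sq_nonneg _) (h x hx)
    · push Not at hroot
      refine ⟨∅, by simp, ?_⟩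
      simp only [Lagrange.nodal_empty, mul_one]
      by_contra! hcon
      obtain ⟨⟨x, hx, hx0⟩, y, hy, hy0⟩ := hcon
      obtain ⟨c, hc, hc0⟩ := isPreconnected_Ioo.intermediate_value hx hy
        p.continuous.continuousOn ⟨hx0.le, hy0.le⟩
      exact hroot c hc hc0

/-! ### The Gauss formula for a positive weight -/

section Gauss

variable {w : ℝ → ℝ} (hw : IntervalIntegrable w MeasureTheory.volume (-1) 1)
  (hpos : ∀ x ∈ Set.Ioo (-1 : ℝ) 1, 0 < w x) (Q : ℕ)
include hw hpos

/-- With fewer than `Q` sign-correcting roots `R` in `(-1,1)`, the nodal polynomial of `R` would be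
orthogonal to `orthoPoly w Q`, although their product has constant sign and so a nonzero integral.
-/
theorem gaussNodes_spec :
    (gaussNodes w Q).card = Q ∧ ∀ x ∈ gaussNodes w Q, x ∈ Set.Ioo (-1 : ℝ) 1 := by
  have hne := (orthoPoly_monic w Q).ne_zero
  obtain ⟨R, hR, hsign⟩ := exists_finset_roots_constant_sign (-1) 1 _ hne
  have hsub : R ⊆ gaussNodes w Q := fun r hr => by
    rw [gaussNodes, Multiset.mem_toFinset, mem_roots hne]
    exact (hR r hr).2
  have hcard : (gaussNodes w Q).card ≤ Q := by
    have h1 := Multiset.toFinset_card_le (orthoPoly w Q).roots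
    have h2 := card_roots' (orthoPoly w Q)
    rw [natDegree_orthoPoly] at h2
    exact h1.trans h2
  have hQR : Q ≤ R.card := by
    by_contra! hlt
    have h0 := weightedIntegral_orthoPoly_mul_eq_zero hw hpos
      (p := Lagrange.nodal R id) (n := Q) (by rw [Lagrange.degree_nodal]; exact_mod_cast hlt)
    have hprod : orthoPoly w Q * Lagrange.nodal R id ≠ 0 :=
      mul_ne_zero hne Lagrange.nodal_ne_zero
    rcases hsign with h | h
    · exact (integral_weight_mul_pos hw hpos hprod h).ne' h0
    · have h3 : 0 < weightedIntegral w hw (-(orthoPoly w Q * Lagrange.nodal R id)) :=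
        integral_weight_mul_pos hw hpos (neg_ne_zero.mpr hprod) fun x hx => by
          rw [eval_neg]
          exact neg_nonneg.mpr (h x hx)
      rw [map_neg, h0, neg_zero] at h3
      exact h3.false
  have heq : R = gaussNodes w Q := Finset.eq_of_subset_of_card_le hsub (hcard.trans hQR)
  subst heq
  exact ⟨le_antisymm hcard hQR, fun x hx => (hR x hx).1⟩

/-- The Gauss formula is exact for polynomials of degree less than `2 Q`. -/
theorem gaussQuadrature_eval_eq {p : ℝ[X]} (hp : p.degree < (2 * Q : ℕ)) :
    gaussQuadrature w Q (fun x => p.eval x) = ∫ x in (-1 : ℝ)..1, w x * p.eval x := by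
  have hmonic := orthoPoly_monic w Q
  have hinj : Set.InjOn (id : ℝ → ℝ) (gaussNodes w Q) := Function.injective_id.injOn
  set r := p %ₘ orthoPoly w Q with hr
  have hrdeg : r.degree < (gaussNodes w Q).card := by
    rw [(gaussNodes_spec hw hpos Q).1, ← degree_orthoPoly w Q]
    exact degree_modByMonic_lt p hmonic
  have hqdeg : (p /ₘ orthoPoly w Q).degree < Q := by
    by_cases h0 : p /ₘ orthoPoly w Q = 0
    · rw [h0, degree_zero]
      exact WithBot.bot_lt_coe Q
    · rw [← natDegree_lt_iff_degree_lt h0, natDegree_divByMonic p hmonic, natDegree_orthoPoly]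
      have hp0 : p ≠ 0 := fun h => h0 (by rw [h, zero_divByMonic])
      have h1 := (natDegree_lt_iff_degree_lt hp0).mpr hp
      have hQ : Q ≠ 0 := by omega
      omega
  have hnode : ∀ x ∈ gaussNodes w Q, p.eval x = r.eval x := by
    intro x hx
    rw [gaussNodes, Multiset.mem_toFinset, mem_roots hmonic.ne_zero] at hx
    conv_lhs => rw [← modByMonic_add_div p (orthoPoly w Q)]
    rw [eval_add, eval_mul, hx.eq_zero, zero_mul, add_zero]
  -- The quotient has degree below `Q`, so orthogonality kills its contribution.
  have hint : weightedIntegral w hw p = weightedIntegral w hw r := by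
    conv_lhs => rw [← modByMonic_add_div p (orthoPoly w Q)]
    rw [map_add, weightedIntegral_orthoPoly_mul_eq_zero hw hpos hqdeg, add_zero]
  change _ = weightedIntegral w hw p
  rw [hint, Lagrange.eq_interpolate hinj hrdeg, Lagrange.interpolate_apply, map_sum,
    gaussQuadrature]
  refine Finset.sum_congr rfl fun x hx => ?_
  rw [← smul_eq_C_mul, map_smul, hnode x hx, smul_eq_mul, mul_comm]
  rfl

/-- The squared Lagrange basis polynomial has degree `2Q - 2`, so exactness identifies the weight
with `∫ w B²`. -/
theorem gaussWeight_nonneg {ξ : ℝ} (hξ : ξ ∈ gaussNodes w Q) : 0 ≤ gaussWeight w Q ξ := by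
  set B := Lagrange.basis (gaussNodes w Q) id ξ with hB
  have hinj : Set.InjOn (id : ℝ → ℝ) (gaussNodes w Q) := Function.injective_id.injOn
  have hcard := (gaussNodes_spec hw hpos Q).1
  have hB0 : B ≠ 0 := Lagrange.basis_ne_zero hinj hξ
  have hQ : 0 < Q := hcard ▸ Finset.card_pos.mpr ⟨ξ, hξ⟩
  have hdeg : (B * B).degree < (2 * Q : ℕ) := by
    rw [← natDegree_lt_iff_degree_lt (mul_ne_zero hB0 hB0), natDegree_mul hB0 hB0, hB,
      Lagrange.natDegree_basis hinj hξ, hcard]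
    omega
  have h := gaussQuadrature_eval_eq hw hpos Q hdeg
  rw [gaussQuadrature, Finset.sum_eq_single_of_mem ξ hξ] at h
  · have h1 : B.eval ξ = 1 := Lagrange.eval_basis_self hinj hξ
    rw [eval_mul, h1, mul_one, mul_one] at h
    rw [h]
    exact (weightedIntegral_sq_pos hw hpos hB0).le
  · intro x hx hne
    have h0 : B.eval x = 0 := Lagrange.eval_basis_of_ne (v := id) hne.symm hx
    rw [eval_mul, h0, zero_mul, mul_zero]

/-- The error of the Gauss formula is at most `2 ∫ w` times the distance of the integrand from the
polynomials of degree less than `2 Q`. -/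
theorem abs_integral_sub_gaussQuadrature_le (hQ : Q ≠ 0) {f : ℝ → ℝ} (hf : Continuous f) {p : ℝ[X]}
    (hp : p.degree < (2 * Q : ℕ)) {δ : ℝ}
    (hδ : ∀ x ∈ Set.Icc (-1 : ℝ) 1, |f x - p.eval x| ≤ δ) :
    |(∫ x in (-1 : ℝ)..1, w x * f x) - gaussQuadrature w Q f| ≤
      2 * (∫ x in (-1 : ℝ)..1, w x) * δ := by
  have hexact := gaussQuadrature_eval_eq hw hpos Q hp
  have hone : ∑ ξ ∈ gaussNodes w Q, gaussWeight w Q ξ = ∫ x in (-1 : ℝ)..1, w x := by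
    have h := gaussQuadrature_eval_eq hw hpos Q (p := 1)
      (by rw [degree_one]; exact_mod_cast (by omega : 0 < 2 * Q))
    simpa [gaussQuadrature] using h
  -- Exactness lets `p` be subtracted in both terms; each then contributes at most `(∫ w) δ`.
  have hsplit : (∫ x in (-1 : ℝ)..1, w x * f x) - gaussQuadrature w Q f =
      (∫ x in (-1 : ℝ)..1, w x * (f x - p.eval x)) -
        ∑ ξ ∈ gaussNodes w Q, gaussWeight w Q ξ * (f ξ - p.eval ξ) := by
    simp only [mul_sub]
    rw [intervalIntegral.integral_sub (intervalIntegrable_weight_mul hw hf)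
      (intervalIntegrable_weight_mul hw p.continuous), ← hexact, Finset.sum_sub_distrib]
    simp only [gaussQuadrature]
    ring
  have hI : |∫ x in (-1 : ℝ)..1, w x * (f x - p.eval x)| ≤ (∫ x in (-1 : ℝ)..1, w x) * δ := by
    rw [← intervalIntegral.integral_mul_const, ← Real.norm_eq_abs]
    refine intervalIntegral.norm_integral_le_of_norm_le (by norm_num) ?_ (hw.mul_const δ)
    have h1 : ∀ᵐ x : ℝ, x ≠ 1 := by simp [MeasureTheory.ae_iff]
    filter_upwards [h1] with x hx hm
    have hwx := hpos x ⟨hm.1, lt_of_le_of_ne hm.2 hx⟩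
    rw [Real.norm_eq_abs, abs_mul, abs_of_pos hwx]
    exact mul_le_mul_of_nonneg_left (hδ x ⟨hm.1.le, hm.2⟩) hwx.le
  have hS : |∑ ξ ∈ gaussNodes w Q, gaussWeight w Q ξ * (f ξ - p.eval ξ)| ≤
      (∫ x in (-1 : ℝ)..1, w x) * δ := by
    rw [← hone, Finset.sum_mul]
    refine (Finset.abs_sum_le_sum_abs _ _).trans (Finset.sum_le_sum fun ξ hξ => ?_)
    have h1 := gaussWeight_nonneg hw hpos Q hξ
    rw [abs_mul, abs_of_nonneg h1]
    exact mul_le_mul_of_nonneg_left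
      (hδ ξ (Set.Ioo_subset_Icc_self ((gaussNodes_spec hw hpos Q).2 ξ hξ))) h1
  rw [hsplit]
  refine (abs_sub _ _).trans ((add_le_add hI hS).trans_eq ?_)
  ring

end Gauss

/-! ### The Jacobi weight and the transformed integrand -/

theorem intervalIntegrable_jacobiWeight {α : ℝ} (hα : α < 1) :
    IntervalIntegrable (jacobiWeight α) MeasureTheory.volume (-1) 1 := by
  have h := (intervalIntegral.intervalIntegrable_rpow' (a := 0) (b := 2)
    (by linarith : -1 < -α)).comp_add_left (c := 1)
  norm_num at h
  exact h

theorem jacobiWeight_pos (α : ℝ) {x : ℝ} (hx : x ∈ Set.Ioo (-1 : ℝ) 1) : 0 < jacobiWeight α x :=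
  Real.rpow_pos_of_pos (by linarith [hx.1]) _

theorem integral_jacobiWeight {α : ℝ} (hα : α < 1) :
    ∫ x in (-1 : ℝ)..1, jacobiWeight α x = 2 ^ (1 - α) / (1 - α) := by
  simp only [jacobiWeight]
  rw [intervalIntegral.integral_comp_add_left (fun x => x ^ (-α)),
    integral_rpow (Or.inl (by linarith))]
  norm_num
  rw [Real.zero_rpow (by linarith), neg_add_eq_sub, sub_zero]

theorem I₀_eq_integral {α L₀ : ℝ} (t : ℝ) (hL₀ : 0 < L₀) :
    I₀ α L₀ t = ∫ x in (-1 : ℝ)..1, f₀ α L₀ t x * jacobiWeight α x := by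
  have hc : 0 < L₀ / 2 := by positivity
  have h := intervalIntegral.integral_comp_mul_add (a := -1) (b := 1)
    (fun x : ℝ => x ^ (-α) * Real.exp (-t * x)) hc.ne' (L₀ / 2)
  rw [show L₀ / 2 * -1 + L₀ / 2 = 0 by ring, show L₀ / 2 * 1 + L₀ / 2 = L₀ by ring, smul_eq_mul,
    eq_inv_mul_iff_mul_eq₀ hc.ne'] at h
  rw [I₀, ← h, ← mul_assoc, ← intervalIntegral.integral_const_mul]
  refine intervalIntegral.integral_congr fun x hx => ?_
  rw [Set.uIcc_of_le (by norm_num)] at hx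
  simp only [f₀, jacobiWeight]
  rw [show L₀ / 2 * x + L₀ / 2 = L₀ / 2 * (1 + x) by ring,
    Real.mul_rpow hc.le (by linarith [hx.1]), sub_eq_add_neg 1 α, Real.rpow_add hc, Real.rpow_one,
    show -t * (L₀ / 2 * (1 + x)) = -t * (x + 1) * L₀ / 2 by ring]
  ring

theorem f₀_eq (α L₀ t : ℝ) : f₀ α L₀ t = fun x =>
    (1 / Real.Gamma (1 - α) * (L₀ / 2) ^ (1 - α) * Real.exp (-(t * L₀ / 2))) *
      Real.exp (-(t * L₀ / 2) * x) := by
  ext x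
  rw [f₀, mul_assoc _ (Real.exp _), ← Real.exp_add]
  ring_nf

theorem contDiff_f₀ (α L₀ t : ℝ) : ContDiff ℝ ∞ (f₀ α L₀ t) := by
  rw [f₀_eq]
  fun_prop

theorem abs_iteratedDeriv_f₀_le {α L₀ t : ℝ} (hα : α < 1) (hL₀ : 0 < L₀) (ht : 0 ≤ t) (n : ℕ)
    {x : ℝ} (hx : x ∈ Set.Icc (-1 : ℝ) 1) :
    |iteratedDeriv n (f₀ α L₀ t) x| ≤
      1 / Real.Gamma (1 - α) * (L₀ / 2) ^ (1 - α) * (t * L₀ / 2) ^ n := by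
  have hΓ : 0 < Real.Gamma (1 - α) := Real.Gamma_pos_of_pos (by linarith)
  have hs : 0 ≤ t * L₀ / 2 := by positivity
  rw [f₀_eq, iteratedDeriv_const_mul_field, iteratedDeriv_exp_const_mul]
  beta_reduce
  rw [abs_mul, abs_mul _ (Real.exp _), abs_mul (_ ^ n), abs_pow, abs_neg, abs_of_nonneg hs, Real.abs_exp,
    Real.abs_exp, abs_of_pos (by positivity), mul_assoc _ (Real.exp _)]
  refine mul_le_mul_of_nonneg_left ?_ (by positivity)
  rw [mul_left_comm, ← Real.exp_add]
  refine mul_le_of_le_one_right (by positivity) (Real.exp_le_one_iff.mpr ?_)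
  -- The combined exponent is `-(tL₀/2)(1 + x)`, nonpositive on `[-1,1]`.
  nlinarith [hx.1]

/-- The number `n^n / n!` is a single term of the series for `e^n`. -/
theorem div_exp_one_pow_le_factorial (n : ℕ) : ((n : ℝ) / Real.exp 1) ^ n ≤ n.factorial := by
  have h := Real.pow_div_factorial_le_exp (x := n) (Nat.cast_nonneg n) n
  rw [div_le_iff₀ (by positivity)] at h
  rw [div_pow, ← Real.exp_nat_mul, mul_one, div_le_iff₀ (by positivity), mul_comm]
  exact h

theorem abs_tauGJ_le {α L₀ t : ℝ} {Q : ℕ} (hα : α < 1) (hL₀ : 0 < L₀) (ht : 0 ≤ t) (hQ : Q ≠ 0) :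
    |tauGJ α L₀ t Q| ≤ 4 * L₀ ^ (1 - α) / Real.Gamma (2 - α) *
      ((t * L₀ / 4) ^ (2 * Q) / (2 * Q).factorial) := by
  obtain ⟨p, hp, h⟩ := exists_polynomial_approx (n := 2 * Q) (by omega) (contDiff_f₀ α L₀ t)
    fun x hx => abs_iteratedDeriv_f₀_le hα hL₀ ht (2 * Q) hx
  have herr := abs_integral_sub_gaussQuadrature_le (intervalIntegrable_jacobiWeight hα)
    (fun x hx => jacobiWeight_pos α hx) Q hQ (contDiff_f₀ α L₀ t).continuous hp h
  simp only [mul_comm (jacobiWeight α _)] at herr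
  rw [integral_jacobiWeight hα] at herr
  refine herr.trans_eq ?_
  have hΓ : 0 < Real.Gamma (1 - α) := Real.Gamma_pos_of_pos (by linarith)
  have hα' : 0 < 1 - α := by linarith
  -- One factor `2` comes from the exponent `2Q - 1`, the other from the error bound; together they
  -- give the `4`. The powers `2^(1-α)` cancel.
  have hpow : (2 : ℝ) ^ (2 * Q) = 2 * 2 ^ (2 * Q - 1) := by
    rw [← pow_succ']
    congr 1
    omega
  rw [show 2 - α = (1 - α) + 1 by ring, Real.Gamma_add_one hα'.ne',
    Real.div_rpow hL₀.le zero_le_two, show t * L₀ / 4 = t * L₀ / 2 / 2 by ring,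
    div_pow (t * L₀ / 2) 2, hpow]
  field_simp
  ring

theorem pow_div_factorial_le {s : ℝ} (hs : 0 ≤ s) {n : ℕ} (hn : n ≠ 0) :
    s ^ n / n.factorial ≤ (Real.exp 1 * s / n) ^ n := by
  have hn' : (0 : ℝ) < n := by exact_mod_cast Nat.pos_of_ne_zero hn
  calc s ^ n / n.factorial ≤ s ^ n / ((n : ℝ) / Real.exp 1) ^ n := by
        gcongr
        exact div_exp_one_pow_le_factorial n
    _ = (Real.exp 1 * s / n) ^ n := by
        rw [← div_pow]
        congr 1
        field_simp

end GaussJacobi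

/-- The integral on the reference interval is `I₀`, and the Gauss–Jacobi error obeys the bound. -/
theorem mainTheorem6 (α L₀ T t : ℝ) (Q : ℕ)
    (hα : α ∈ Set.Ioo (0 : ℝ) 1) (hL₀ : 0 < L₀) (hT : 0 < T)
    (ht : t ∈ Set.Icc (0 : ℝ) T) (hQ : 1 ≤ Q) :
    GaussJacobi.I₀ α L₀ t =
        ∫ x in (-1 : ℝ)..1, GaussJacobi.f₀ α L₀ t x * GaussJacobi.jacobiWeight α x ∧
    |GaussJacobi.tauGJ α L₀ t Q| ≤
      4 * L₀ ^ (1 - α) / Real.Gamma (2 - α) * (1 + T * L₀ / (4 * (Q : ℝ))) *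
        (Real.exp 1 * T * L₀ / (8 * (Q : ℝ))) ^ (2 * Q) := by
  refine ⟨GaussJacobi.I₀_eq_integral t hL₀, ?_⟩
  have hΓ : 0 < Real.Gamma (2 - α) := Real.Gamma_pos_of_pos (by linarith [hα.2])
  have hQ' : (0 : ℝ) < Q := by exact_mod_cast hQ
  have ht0 := ht.1
  refine (GaussJacobi.abs_tauGJ_le hα.2 hL₀ ht0 (by omega)).trans ?_
  rw [mul_assoc (4 * L₀ ^ (1 - α) / Real.Gamma (2 - α))]
  refine mul_le_mul_of_nonneg_left ?_ (by positivity)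
  calc (t * L₀ / 4) ^ (2 * Q) / (2 * Q).factorial
      ≤ (Real.exp 1 * (t * L₀ / 4) / (2 * Q : ℕ)) ^ (2 * Q) :=
        GaussJacobi.pow_div_factorial_le (by positivity) (by omega)
    _ = (Real.exp 1 * t * L₀ / (8 * (Q : ℝ))) ^ (2 * Q) := by
        push_cast
        congr 1
        field_simp
        ring
    _ ≤ (Real.exp 1 * T * L₀ / (8 * (Q : ℝ))) ^ (2 * Q) := by
        gcongr
        exact ht.2
    _ ≤ _ := le_mul_of_one_le_left (by positivity) (le_add_of_nonneg_right (by positivity))
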